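/- Let $\varphi$ be an increasing (not necessarily strictly) positive function on $\mathbb{R}_+=(0,\infty)$ such that $\lim_{x\to\infty}\varphi(x)=\infty$. Then there exists a strongly annular function $f$, i.e. a function $f(z)=\sum_{n\ge 0}\widehat f(n)z^n$ analytic in the open unit disc $\{|z|<1\}$ with $$\limsup_{r\to1^-}\ \min_{|z|=r}|f(z)|=\infty,$$ whose Taylor coefficients $\widehat f(n)=f^{(n)}(0)/n!$ satisfy both $$\sum_{n\ge0}\frac{|\widehat f(n)|^2}{\varphi\bigl(1/|\widehat f(n)|\bigr)}<\infty\qquad\text{and}\qquad \sum_{k\ge0}\min\bigl(|\widehat f(2k)|^2,|\widehat f(2k+1)|^2\bigr)=\infty,$$ where in the first sum the terms with $\widehat f(n)=0$ are taken to be $0$. -/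

import Mathlib

open Filter Topology

/-- The `n`-th Taylor coefficient at the origin, `f⁽ⁿ⁾(0) / n!`. -/
noncomputable def taylorCoeff (f : ℂ → ℂ) (n : ℕ) : ℂ :=
  iteratedDeriv n f 0 / (n.factorial : ℂ)

/-- `f` is analytic in the open unit disc and
`limsup_{r → 1⁻} min_{|z| = r} |f(z)| = ∞`, the limsup being taken in `[0, ∞]`.
For `0 < r < 1` the circle is compact and nonempty and `f` is continuous on it, so that the
infimum is a minimum. -/
def StronglyAnnular (f : ℂ → ℂ) : Prop :=
  AnalyticOnNhd ℂ f (Metric.ball 0 1) ∧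
    limsup (fun r : ℝ => ⨅ z ∈ Metric.sphere (0 : ℂ) r, ‖f z‖ₑ) (𝓝[<] (1 : ℝ)) = ⊤

/-- The sequences `a` with `∑ |aₙ|² / φ(1/|aₙ|) < ∞`, for `φ` positive on `(0, ∞)`. A term with
`aₙ = 0` contributes `0`, whatever the value of `φ` at `0`. -/
def ellTwoPhi (φ : ℝ → ℝ) : Set (ℕ → ℂ) :=
  {a | Summable fun n : ℕ => ‖a n‖ ^ 2 / φ (1 / ‖a n‖)}

/-- The sequences `a` with `∑ min (|a₂ₖ|², |a₂ₖ₊₁|²) < ∞`. -/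
def ellTwoTilde : Set (ℕ → ℂ) :=
  {a | Summable fun k : ℕ => min (‖a (2 * k)‖ ^ 2) (‖a (2 * k + 1)‖ ^ 2)}

/-! The function is a lacunary-style sum of polynomial blocks. The obstacle is a block that is large
on the whole unit circle yet has tiny coefficients and controlled ℓ² norm. A Blaschke factor is
unimodular on the circle and has ℓ² norm 1, with all coefficients at most 3/4. Multiplying
truncations of it at `z`, `z ^ L`, ... never superposes terms, so coefficients and ℓ² norms
multiply: the coefficients decay like `(3 / 4) ^ n` while the modulus stays near 1
(`exists_flat_polynomial`). If P is such a polynomial, A(2 + z)P(z²) is large and has comparable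
adjacent coefficients, which makes the sum of minima diverge (`exists_block`). Since A is fixed
before the coefficient size, φ can be made to dominate the ℓ² norm of the block
(`exists_isExtension`). -/

/-! ### Products P(z)Q(z^L) and base-L digits -/

/-- Sums over the integers below `L * D`, written in base `L`, factor. -/
theorem sum_range_mul_mod_div (L D : ℕ) {R : Type*} [CommSemiring R] (f g : ℕ → R) :
    ∑ n ∈ Finset.range (L * D), f (n % L) * g (n / L) =
      (∑ i ∈ Finset.range L, f i) * ∑ j ∈ Finset.range D, g j := by
  induction D with
  | zero => simp
  | succ D ih =>
    rw [Nat.mul_succ, Finset.sum_range_add, ih, Finset.sum_range_succ, mul_add, Finset.sum_mul]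
    congr 1
    rw [Finset.sum_mul]
    refine Finset.sum_congr rfl fun i hi => ?_
    have hi' := Finset.mem_range.1 hi
    have hL : 0 < L := by omega
    rw [Nat.mul_add_mod, Nat.mod_eq_of_lt hi', Nat.mul_add_div hL, Nat.div_eq_of_lt hi', add_zero]

/-- Each exponent has unique base-`L` digits, so no two terms of the product P(z)Q(z^L) share a
power of `z`. -/
theorem sum_range_mul_mod_div_pow (L D : ℕ) (f g : ℕ → ℂ) (z : ℂ) :
    ∑ n ∈ Finset.range (L * D), f (n % L) * g (n / L) * z ^ n =
      (∑ i ∈ Finset.range L, f i * z ^ i) * ∑ j ∈ Finset.range D, g j * (z ^ L) ^ j := by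
  rw [← sum_range_mul_mod_div L D (fun i => f i * z ^ i) (fun j => g j * (z ^ L) ^ j)]
  refine Finset.sum_congr rfl fun n _ => ?_
  conv_lhs => rw [← Nat.mod_add_div n L, pow_add, pow_mul, Nat.mod_add_div n L]
  ring

theorem sum_range_mul_mod_div_norm_sq (L D : ℕ) (f g : ℕ → ℂ) :
    ∑ n ∈ Finset.range (L * D), ‖f (n % L) * g (n / L)‖ ^ 2 =
      (∑ i ∈ Finset.range L, ‖f i‖ ^ 2) * ∑ j ∈ Finset.range D, ‖g j‖ ^ 2 := by
  rw [← sum_range_mul_mod_div L D (fun i => ‖f i‖ ^ 2) (fun j => ‖g j‖ ^ 2)]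
  exact Finset.sum_congr rfl fun n _ => by rw [norm_mul, mul_pow]

/-! ### Flat polynomials from truncated Blaschke factors -/

/-- The Taylor coefficients of the Blaschke factor `(z - 1/2) / (1 - z/2)`. -/
noncomputable def blaschkeCoeff (j : ℕ) : ℂ :=
  if j = 0 then -(1 / 2) else 3 / 4 * (1 / 2) ^ (j - 1)

theorem norm_blaschkeCoeff_le (j : ℕ) : ‖blaschkeCoeff j‖ ≤ 3 / 4 := by
  unfold blaschkeCoeff
  split_ifs
  · norm_num
  · rw [norm_mul, norm_pow]
    have : (1 / 2 : ℝ) ^ (j - 1) ≤ 1 := pow_le_one₀ (by norm_num) (by norm_num)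
    norm_num at this ⊢
    linarith

theorem sum_norm_sq_blaschkeCoeff (d : ℕ) :
    ∑ j ∈ Finset.range (d + 1), ‖blaschkeCoeff j‖ ^ 2 = 1 - 3 / 4 * (1 / 4 : ℝ) ^ d := by
  induction d with
  | zero => norm_num [blaschkeCoeff]
  | succ d ih =>
    have h : ‖blaschkeCoeff (d + 1)‖ ^ 2 = 9 / 16 * (1 / 4 : ℝ) ^ d := by
      simp only [blaschkeCoeff, Nat.add_sub_cancel, Nat.add_eq_zero_iff, one_ne_zero, and_false,
        if_false, norm_mul, norm_pow, mul_pow]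
      rw [← pow_mul, mul_comm d 2, pow_mul]
      norm_num
    rw [Finset.sum_range_succ, ih, h, pow_succ]
    ring

theorem one_sub_mul_sum_blaschkeCoeff (d : ℕ) (z : ℂ) :
    (1 - z / 2) * ∑ j ∈ Finset.range (d + 1), blaschkeCoeff j * z ^ j =
      z - 1 / 2 - 3 / 4 * (1 / 2) ^ d * z ^ (d + 1) := by
  induction d with
  | zero => simp [blaschkeCoeff]; ring
  | succ d ih =>
    rw [Finset.sum_range_succ, mul_add, ih]
    simp only [blaschkeCoeff, Nat.add_sub_cancel, Nat.add_eq_zero_iff, one_ne_zero, and_false,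
        if_false]
    ring

/-- On the circle numerator and denominator of the Blaschke factor have equal modulus, at least 1/2;
dividing the truncation error `3 / 4 * (1 / 2) ^ d` by it costs at most a factor 2. -/
theorem norm_sum_blaschkeCoeff_ge (d : ℕ) {z : ℂ} (hz : ‖z‖ = 1) :
    1 - 3 / 2 * (1 / 2 : ℝ) ^ d ≤ ‖∑ j ∈ Finset.range (d + 1), blaschkeCoeff j * z ^ j‖ := by
  set s := ∑ j ∈ Finset.range (d + 1), blaschkeCoeff j * z ^ j
  have hn : ‖z - 1 / 2‖ = ‖1 - z / 2‖ := by
    have h1 : z.re * z.re + z.im * z.im = 1 := by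
      rw [← Complex.normSq_apply, Complex.normSq_eq_norm_sq, hz]; norm_num
    rw [← sq_eq_sq₀ (norm_nonneg _) (norm_nonneg _), ← Complex.normSq_eq_norm_sq,
      ← Complex.normSq_eq_norm_sq, Complex.normSq_apply, Complex.normSq_apply]
    norm_num
    linear_combination (3 / 4 : ℝ) * h1
  have hlow : 1 / 2 ≤ ‖1 - z / 2‖ := by
    have := norm_sub_norm_le (1 : ℂ) (z / 2)
    rw [norm_div, hz] at this
    norm_num at this ⊢
    linarith
  have hprod := congrArg norm (one_sub_mul_sum_blaschkeCoeff d z)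
  have hsub := norm_sub_norm_le (z - 1 / 2) (3 / 4 * (1 / 2) ^ d * z ^ (d + 1))
  have he : ‖(3 / 4 * (1 / 2) ^ d * z ^ (d + 1) : ℂ)‖ = 3 / 4 * (1 / 2 : ℝ) ^ d := by
    rw [norm_mul, norm_mul, norm_pow, norm_pow, hz]
    norm_num
  rw [← hprod, he, hn, norm_mul] at hsub
  have hp : 0 ≤ (1 / 2 : ℝ) ^ d := by positivity
  have : 0 ≤ ‖1 - z / 2‖ * (‖s‖ - (1 - 3 / 2 * (1 / 2 : ℝ) ^ d)) := by
    nlinarith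
  have := nonneg_of_mul_nonneg_right this (by linarith)
  linarith

/-- Polynomials with small coefficients and `ℓ²` norm at most `1` whose modulus on the unit circle
is almost at least `1`. -/
theorem exists_flat_polynomial (n : ℕ) : ∀ {η : ℝ}, 0 < η → η ≤ 1 → ∃ (L : ℕ) (b : ℕ → ℂ),
    (∀ i, ‖b i‖ ≤ (3 / 4) ^ n) ∧ 1 - η ≤ ∑ i ∈ Finset.range L, ‖b i‖ ^ 2 ∧
      ∑ i ∈ Finset.range L, ‖b i‖ ^ 2 ≤ 1 ∧
      ∀ z : ℂ, ‖z‖ = 1 → 1 - η ≤ ‖∑ i ∈ Finset.range L, b i * z ^ i‖ := by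
  induction n with
  | zero =>
    intro η h0 _
    refine ⟨1, fun _ => 1, ?_⟩
    simp [h0.le]
  | succ n ih =>
    intro η h0 h1
    obtain ⟨L, b, hb, hl, hu, hz⟩ := ih (η := η / 2) (by linarith) (by linarith)
    -- With `η / 3` the loss `3 / 2 * (1 / 2) ^ d` is below `η / 2`, the share left by the induction
    -- hypothesis.
    obtain ⟨d, hd⟩ := exists_pow_lt_of_lt_one (show 0 < η / 3 by linarith)
      (show (1 / 2 : ℝ) < 1 by norm_num)
    have hd4 : (1 / 4 : ℝ) ^ d ≤ (1 / 2) ^ d :=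
      pow_le_pow_left₀ (by norm_num) (by norm_num) d
    have hd0 : (0 : ℝ) ≤ (1 / 4) ^ d := by positivity
    have hη : 1 - η ≤ (1 - η / 2) * (1 - η / 2) := by nlinarith
    have hη' : 0 ≤ 1 - η / 2 := by linarith
    have hq := sum_norm_sq_blaschkeCoeff d
    refine ⟨L * (d + 1), fun i => b (i % L) * blaschkeCoeff (i / L), fun i => ?_, ?_, ?_,
      fun z h => ?_⟩
    · rw [norm_mul, pow_succ]
      exact mul_le_mul (hb _) (norm_blaschkeCoeff_le _) (norm_nonneg _) (by positivity)
    · rw [sum_range_mul_mod_div_norm_sq]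
      exact hη.trans (mul_le_mul hl (by linarith) hη' (hη'.trans hl))
    · rw [sum_range_mul_mod_div_norm_sq]
      exact mul_le_one₀ hu (Finset.sum_nonneg fun _ _ => by positivity) (by linarith)
    · rw [sum_range_mul_mod_div_pow, norm_mul]
      have := norm_sum_blaschkeCoeff_ge d (z := z ^ L) (by rw [norm_pow, h, one_pow])
      exact hη.trans (mul_le_mul (hz z h) (by linarith) hη' (norm_nonneg _))

/-! ### Large blocks with paired coefficients -/

/-- A polynomial with coefficients at most `ε`, large on the unit circle, whose `ℓ²` norm is bounded
independently of `ε`. -/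
theorem exists_block {A ε : ℝ} (hA : 2 ≤ A) (hε : 0 < ε) : ∃ (L : ℕ) (b : ℕ → ℂ),
    (∀ i, ‖b i‖ ≤ ε) ∧ ∑ i ∈ Finset.range (2 * L), ‖b i‖ ^ 2 ≤ 5 * A ^ 2 ∧
      1 ≤ ∑ i ∈ Finset.range L, min (‖b (2 * i)‖ ^ 2) (‖b (2 * i + 1)‖ ^ 2) ∧
      ∀ z : ℂ, ‖z‖ = 1 → A / 2 ≤ ‖∑ i ∈ Finset.range (2 * L), b i * z ^ i‖ := by
  obtain ⟨n, hn⟩ := exists_pow_lt_of_lt_one (show 0 < ε / (2 * A) by positivity)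
    (show (3 / 4 : ℝ) < 1 by norm_num)
  obtain ⟨L, b, hb, hl, hu, hz⟩ := exists_flat_polynomial n (η := 1 / 2) (by norm_num) (by norm_num)
  rw [lt_div_iff₀ (by positivity)] at hn
  -- Coefficients of A(2 + z): modulus at least A on the circle, squared ℓ² norm 5A², smaller
  -- coefficient A.
  set a : ℕ → ℂ := fun i => if i = 0 then 2 * A else A
  have hA0 : 0 ≤ A := by linarith
  have hnA : ‖(A : ℂ)‖ = A := by rw [Complex.norm_real, Real.norm_of_nonneg hA0]
  have ha : ∀ i, ‖a i‖ ≤ 2 * A := fun i => by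
    simp only [a]
    split_ifs
    · rw [norm_mul, hnA]; norm_num
    · rw [hnA]; linarith
  refine ⟨L, fun i => a (i % 2) * b (i / 2), fun i => ?_, ?_, ?_, fun z h => ?_⟩
  · rw [norm_mul]
    have := mul_le_mul (ha (i % 2)) (hb (i / 2)) (norm_nonneg _) (by positivity)
    linarith
  · rw [sum_range_mul_mod_div_norm_sq]
    have : ∑ i ∈ Finset.range 2, ‖a i‖ ^ 2 = 5 * A ^ 2 := by
      simp [Finset.sum_range_succ, a, abs_of_nonneg hA0]; ring
    rw [this]
    exact mul_le_of_le_one_right (by positivity) hu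
  · have h1 : ∀ i, ‖b i‖ ^ 2 * A ^ 2 ≤ min (‖a (2 * i % 2) * b (2 * i / 2)‖ ^ 2)
        (‖a ((2 * i + 1) % 2) * b ((2 * i + 1) / 2)‖ ^ 2) := fun i => by
      have e1 : 2 * i % 2 = 0 := by omega
      have e2 : 2 * i / 2 = i := by omega
      have e3 : (2 * i + 1) % 2 = 1 := by omega
      have e4 : (2 * i + 1) / 2 = i := by omega
      rw [e1, e2, e3, e4]
      simp only [a, if_true, one_ne_zero, if_false, norm_mul, hnA, mul_pow]
      norm_num
      constructor <;> nlinarith [mul_nonneg (sq_nonneg ‖b i‖) (sq_nonneg A)]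
    refine le_trans ?_ (Finset.sum_le_sum fun i _ => h1 i)
    rw [← Finset.sum_mul]
    nlinarith
  · rw [sum_range_mul_mod_div_pow, norm_mul]
    have h2 : A ≤ ‖∑ i ∈ Finset.range 2, a i * z ^ i‖ := by
      have e : ∑ i ∈ Finset.range 2, a i * z ^ i = 2 * A - -(A * z) := by
        simp [Finset.sum_range_succ, a]
      rw [e]
      have := norm_sub_norm_le (2 * A : ℂ) (-(A * z))
      rw [norm_neg, norm_mul, norm_mul, h, hnA] at this
      norm_num at this
      norm_num
      linarith
    have := mul_le_mul h2 (hz (z ^ 2) (by rw [norm_pow, h, one_pow])) (by norm_num) (norm_nonneg _)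
    linarith

/-! ### Gluing the blocks -/

/-- A lower bound for a polynomial on the unit circle persists on circles of radius close to `1`. -/
theorem eventually_lt_norm_sum_pow {N : ℕ} {c : ℕ → ℂ} {K : ℝ}
    (h : ∀ z : ℂ, ‖z‖ = 1 → K < ‖∑ i ∈ Finset.range N, c i * z ^ i‖) :
    ∀ᶠ r in 𝓝[<] (1 : ℝ), ∀ z : ℂ, ‖z‖ = r → K < ‖∑ i ∈ Finset.range N, c i * z ^ i‖ := by
  obtain ⟨δ, hδ, hsub⟩ := (isCompact_sphere (0 : ℂ) 1).exists_thickening_subset_open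
    (isOpen_lt (continuous_const (y := K))
      (show Continuous fun z : ℂ => ‖∑ i ∈ Finset.range N, c i * z ^ i‖ by fun_prop))
    (fun z hz => h z (by simpa using hz))
  have h1 : max 0 (1 - δ) < (1 : ℝ) := by
    rw [max_lt_iff]; constructor <;> linarith
  filter_upwards [Ioo_mem_nhdsLT h1] with r hr z hz
  obtain ⟨hr0, hrδ⟩ := max_lt_iff.1 hr.1
  refine hsub (Metric.mem_thickening_iff.2 ⟨z / r, ?_, ?_⟩)
  · have : (r : ℝ) ≠ 0 := hr0.ne'
    simp [hz, abs_of_pos hr0, this]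
  · have hz0 : (r : ℂ) ≠ 0 := by exact_mod_cast hr0.ne'
    have e : z - z / r = (z / r) * ((r - 1 : ℝ) : ℂ) := by
      push_cast; field_simp
    rw [dist_eq_norm, e, norm_mul, norm_div, Complex.norm_real, Complex.norm_real, hz,
      Real.norm_of_nonneg hr0.le, div_self hr0.ne', one_mul, Real.norm_eq_abs, abs_sub_comm,
      abs_of_pos (by linarith [hr.2])]
    linarith

theorem norm_sq_div_le {φ : ℝ → ℝ} {K x : ℝ} (hK : 0 < K) (hx : 0 < x)
    (h : ∀ y, x ≤ y → K ≤ φ y) {w : ℂ} (hw : ‖w‖ ≤ 1 / x) :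
    ‖w‖ ^ 2 / φ (1 / ‖w‖) ≤ ‖w‖ ^ 2 / K := by
  rcases eq_or_ne w 0 with rfl | h0
  · simp
  · have hp : 0 < ‖w‖ := norm_pos_iff.2 h0
    have : x ≤ 1 / ‖w‖ := (le_one_div hx hp).2 hw
    exact div_le_div_of_nonneg_left (by positivity) hK (h _ this)

/-- The extension `c` of a finite sequence `c₀` of length `2 * M₀` to one of length `2 * M`, with
small contribution to `ellTwoPhi`, contribution at least `1` to `ellTwoTilde`, and whose
power series exceeds `k` on some circle of radius close to `1`. -/
structure IsExtension (φ : ℝ → ℝ) (k : ℕ) (c₀ : ℕ → ℂ) (M₀ : ℕ) (c : ℕ → ℂ) (M : ℕ) : Prop where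
  lt : M₀ < M
  eq : ∀ i < 2 * M₀, c i = c₀ i
  norm_le : ∀ i, 2 * M₀ ≤ i → i < 2 * M → ‖c i‖ ≤ 1
  phi_le : ∑ i ∈ Finset.Ico (2 * M₀) (2 * M), ‖c i‖ ^ 2 / φ (1 / ‖c i‖) ≤ (1 / 2) ^ k
  le_tilde : 1 ≤ ∑ i ∈ Finset.Ico M₀ M, min (‖c (2 * i)‖ ^ 2) (‖c (2 * i + 1)‖ ^ 2)
  large : ∃ r : ℝ, 1 - 1 / ((k : ℝ) + 1) < r ∧ 0 < r ∧ r < 1 ∧ r ^ (2 * M) / (1 - r) ≤ 1 ∧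
    ∀ z : ℂ, ‖z‖ = r → (k : ℝ) + 1 ≤ ‖∑ i ∈ Finset.range (2 * M), c i * z ^ i‖

theorem exists_isExtension {φ : ℝ → ℝ} (hlim : Tendsto φ atTop atTop) (k : ℕ) (c₀ : ℕ → ℂ) (M₀ : ℕ) :
    ∃ c M, IsExtension φ k c₀ M₀ c M := by
  set S := ∑ i ∈ Finset.range (2 * M₀), ‖c₀ i‖
  have hS : 0 ≤ S := Finset.sum_nonneg fun _ _ => norm_nonneg _
  -- `A / 2` beats the old polynomial, at most `S` on the circle, by `k + 2`.
  set A : ℝ := 2 * (k + 2 + S)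
  have hA : 2 ≤ A := by
    have : (0 : ℝ) ≤ k := by positivity
    simp only [A]; linarith
  set K : ℝ := 5 * A ^ 2 * 2 ^ k
  have hK : 0 < K := by positivity
  obtain ⟨x₀, hx₀⟩ := eventually_atTop.1 (hlim.eventually_ge_atTop K)
  set x := max x₀ 1
  have hx1 : 1 ≤ x := le_max_right _ _
  have hx : ∀ y, x ≤ y → K ≤ φ y := fun y hy => hx₀ y ((le_max_left _ _).trans hy)
  have hx0 : 0 < x := by linarith
  obtain ⟨L, b, hb, hsq, hmin, hlow⟩ := exists_block hA (one_div_pos.2 hx0)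
  set c : ℕ → ℂ := fun i => if i < 2 * M₀ then c₀ i else b (i - 2 * M₀)
  have hc1 : ∀ i < 2 * M₀, c i = c₀ i := fun i hi => if_pos hi
  have hc2 : ∀ i, c (2 * M₀ + i) = b i := fun i => by simp [c]
  have hL : 0 < L := by
    rcases Nat.eq_zero_or_pos L with rfl | h
    · norm_num at hmin
    · exact h
  have hbig : ∀ z : ℂ, ‖z‖ = 1 →
      (k : ℝ) + 1 < ‖∑ i ∈ Finset.range (2 * (M₀ + L)), c i * z ^ i‖ := fun z hz => by
    have e : ∑ i ∈ Finset.range (2 * (M₀ + L)), c i * z ^ i =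
        z ^ (2 * M₀) * (∑ i ∈ Finset.range (2 * L), b i * z ^ i) -
          -∑ i ∈ Finset.range (2 * M₀), c₀ i * z ^ i := by
      rw [mul_add, Finset.sum_range_add, sub_neg_eq_add, add_comm, Finset.mul_sum]
      congr 1
      · exact Finset.sum_congr rfl fun i _ => by rw [hc2, pow_add]; ring
      · exact Finset.sum_congr rfl fun i hi => by rw [hc1 i (Finset.mem_range.1 hi)]
    rw [e]
    have h1 := norm_sub_norm_le (z ^ (2 * M₀) * ∑ i ∈ Finset.range (2 * L), b i * z ^ i)
      (-∑ i ∈ Finset.range (2 * M₀), c₀ i * z ^ i)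
    rw [norm_mul, norm_pow, hz, one_pow, one_mul, norm_neg] at h1
    have h2 : ‖∑ i ∈ Finset.range (2 * M₀), c₀ i * z ^ i‖ ≤ S :=
      (norm_sum_le _ _).trans_eq (Finset.sum_congr rfl fun i _ => by simp [hz])
    have h3 := hlow z hz
    simp only [A] at h3
    linarith
  have hr1 : (1 : ℝ) - 1 / ((k : ℝ) + 1) < 1 := by
    have : (0 : ℝ) < 1 / ((k : ℝ) + 1) := by positivity
    linarith
  obtain ⟨r, ⟨hrbig, hrk, -⟩, hr0, hr1⟩ := (((eventually_lt_norm_sum_pow hbig).and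
    (Ioo_mem_nhdsLT hr1)).and (Ioo_mem_nhdsLT (zero_lt_one' ℝ))).exists
  -- The radius `r` depends on the polynomial, so `m` pairs of zeros are appended afterwards: any
  -- later terms with coefficients at most 1 then contribute at most 1 on this circle.
  obtain ⟨m, hm⟩ := exists_pow_lt_of_lt_one (show 0 < 1 - r by linarith) hr1
  set c' : ℕ → ℂ := fun i => if i < 2 * (M₀ + L) then c i else 0
  have hc' : ∀ i < 2 * (M₀ + L), c' i = c i := fun i hi => if_pos hi
  have hc'0 : ∀ i, ¬ i < 2 * (M₀ + L) → c' i = 0 := fun i hi => if_neg hi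
  refine ⟨c', M₀ + L + m, by omega, fun i hi => ?_, fun i hi _ => ?_, ?_, ?_, r, hrk, hr0, hr1,
    ?_, fun z hz => ?_⟩
  · rw [hc' i (by omega), hc1 i hi]
  · by_cases h : i < 2 * (M₀ + L)
    · obtain ⟨j, rfl⟩ := Nat.exists_eq_add_of_le hi
      rw [hc' _ h, hc2]
      exact (hb j).trans ((div_le_one hx0).2 hx1)
    · rw [hc'0 i h]; simp
  · have h1 : ∑ i ∈ Finset.Ico (2 * M₀) (2 * (M₀ + L + m)), ‖c' i‖ ^ 2 / φ (1 / ‖c' i‖) =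
        ∑ i ∈ Finset.range (2 * L), ‖b i‖ ^ 2 / φ (1 / ‖b i‖) := by
      rw [← Finset.sum_Ico_consecutive _ (show 2 * M₀ ≤ 2 * (M₀ + L) by omega)
        (show 2 * (M₀ + L) ≤ 2 * (M₀ + L + m) by omega), Finset.sum_Ico_eq_sum_range]
      rw [Finset.sum_eq_zero (s := Finset.Ico (2 * (M₀ + L)) _) fun i hi => by
        rw [hc'0 i (by have := Finset.mem_Ico.1 hi; omega)]; simp, add_zero]
      rw [show 2 * (M₀ + L) - 2 * M₀ = 2 * L by omega]
      refine Finset.sum_congr rfl fun i hi => ?_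
      rw [hc' _ (by have := Finset.mem_range.1 hi; omega), hc2]
    rw [h1]
    calc _ ≤ ∑ i ∈ Finset.range (2 * L), ‖b i‖ ^ 2 / K :=
          Finset.sum_le_sum fun i _ => norm_sq_div_le hK hx0 hx (hb i)
      _ = (∑ i ∈ Finset.range (2 * L), ‖b i‖ ^ 2) / K := by rw [Finset.sum_div]
      _ ≤ 5 * A ^ 2 / K := by gcongr
      _ = (1 / 2) ^ k := by
          simp only [K]
          rw [one_div_pow]
          have : A ≠ 0 := by linarith
          field_simp
  · refine hmin.trans ?_
    have h1 : ∑ i ∈ Finset.range L, min (‖b (2 * i)‖ ^ 2) (‖b (2 * i + 1)‖ ^ 2) =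
        ∑ i ∈ Finset.Ico M₀ (M₀ + L), min (‖c' (2 * i)‖ ^ 2) (‖c' (2 * i + 1)‖ ^ 2) := by
      rw [Finset.sum_Ico_eq_sum_range, Nat.add_sub_cancel_left]
      refine Finset.sum_congr rfl fun i hi => ?_
      have := Finset.mem_range.1 hi
      rw [hc' _ (by omega), hc' _ (by omega), show 2 * (M₀ + i) + 1 = 2 * M₀ + (2 * i + 1) by ring,
        mul_add, hc2, hc2]
    rw [h1]
    exact Finset.sum_le_sum_of_subset_of_nonneg (Finset.Ico_subset_Ico_right (by omega))
      fun _ _ _ => by positivity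
  · rw [div_le_one (by linarith)]
    exact (pow_le_pow_of_le_one hr0.le hr1.le (by omega)).trans hm.le
  · rw [show 2 * (M₀ + L + m) = 2 * (M₀ + L) + 2 * m by ring, Finset.sum_range_add,
      Finset.sum_eq_zero (s := Finset.range (2 * m)) fun i _ => by
        rw [hc'0 _ (by omega), zero_mul], add_zero,
      Finset.sum_congr rfl fun i hi => by rw [hc' i (Finset.mem_range.1 hi)]]
    exact (hrbig z hz).le

theorem IsExtension.congr {φ : ℝ → ℝ} {k : ℕ} {c₀ c : ℕ → ℂ} {M₀ M : ℕ}
    (h : IsExtension φ k c₀ M₀ c M) {c' : ℕ → ℂ} (hc : ∀ i < 2 * M, c' i = c i) :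
    IsExtension φ k c' M₀ c' M where
  lt := h.lt
  eq _ _ := rfl
  norm_le i h1 h2 := by rw [hc i h2]; exact h.norm_le i h1 h2
  phi_le := by
    rw [Finset.sum_congr rfl fun i hi => by rw [hc i (Finset.mem_Ico.1 hi).2]]
    exact h.phi_le
  le_tilde := by
    rw [Finset.sum_congr rfl fun i hi => by
      have := (Finset.mem_Ico.1 hi).2
      rw [hc (2 * i) (by omega), hc (2 * i + 1) (by omega)]]
    exact h.le_tilde
  large := by
    obtain ⟨r, h1, h2, h3, h4, h5⟩ := h.large
    refine ⟨r, h1, h2, h3, h4, fun z hz => ?_⟩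
    rw [Finset.sum_congr rfl fun i hi => by rw [hc i (Finset.mem_range.1 hi)]]
    exact h5 z hz

/-- A sequence `c` all of whose initial segments of length `2 * M k` are successive extensions. -/
theorem exists_seq_isExtension {φ : ℝ → ℝ} (hlim : Tendsto φ atTop atTop) :
    ∃ (c : ℕ → ℂ) (M : ℕ → ℕ), M 0 = 0 ∧ ∀ k, IsExtension φ k c (M k) c (M (k + 1)) := by
  choose C N hCN using exists_isExtension hlim
  let s : ℕ → (ℕ → ℂ) × ℕ := fun n => Nat.rec (0, 0) (fun k p => (C k p.1 p.2, N k p.1 p.2)) n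
  have hs : ∀ k, IsExtension φ k (s k).1 (s k).2 (s (k + 1)).1 (s (k + 1)).2 :=
    fun k => hCN k (s k).1 (s k).2
  have hmono : StrictMono fun k => (s k).2 := strictMono_nat_of_lt_succ fun k => (hs k).lt
  have hstab : ∀ j k i, i < 2 * (s k).2 → (s (k + j)).1 i = (s k).1 i := by
    intro j
    induction j with
    | zero => intros; rfl
    | succ j ih =>
      intro k i hi
      rw [← ih k i hi]
      have hle : (s k).2 ≤ (s (k + j)).2 := hmono.monotone (Nat.le_add_right k j)
      exact (hs (k + j)).eq i (by omega)
  have hid : ∀ k, k ≤ (s k).2 := hmono.id_le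
  -- Stage `n + 1` has length at least `2 * (n + 1)`, so its `n`-th entry is already final.
  set c : ℕ → ℂ := fun n => (s (n + 1)).1 n
  have hc : ∀ k i, i < 2 * (s k).2 → c i = (s k).1 i := by
    intro k i hi
    rcases le_total k (i + 1) with h | h
    · obtain ⟨j, hj⟩ := Nat.exists_eq_add_of_le h
      simp only [c]
      rw [hj, hstab j k i hi]
    · obtain ⟨j, rfl⟩ := Nat.exists_eq_add_of_le h
      exact (hstab j (i + 1) i (by have := hid (i + 1); omega)).symm
  exact ⟨c, fun k => (s k).2, rfl, fun k => (hs k).congr (hc (k + 1))⟩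

/-! ### From coefficients to the analytic function -/

theorem hasFPowerSeriesOnBall_of_norm_le_one {c : ℕ → ℂ} (hc : ∀ n, ‖c n‖ ≤ 1) :
    HasFPowerSeriesOnBall (fun z => ∑' n, c n * z ^ n)
      (FormalMultilinearSeries.ofScalars ℂ c) 0 1 := by
  have hr : (1 : ENNReal) ≤ (FormalMultilinearSeries.ofScalars ℂ c).radius := by
    refine FormalMultilinearSeries.le_radius_of_bound (r := 1) _ 1 fun n => ?_
    rw [FormalMultilinearSeries.ofScalars_norm]
    simpa using hc n
  have h := (FormalMultilinearSeries.hasFPowerSeriesOnBall _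
    (zero_lt_one.trans_le hr)).mono zero_lt_one hr
  have e : (FormalMultilinearSeries.ofScalars ℂ c).sum = fun z => ∑' n, c n * z ^ n := by
    have := FormalMultilinearSeries.ofScalarsSum_eq_tsum (E := ℂ) (c := c)
    simpa [FormalMultilinearSeries.ofScalarsSum] using this
  rwa [e] at h

theorem taylorCoeff_tsum {c : ℕ → ℂ} (hc : ∀ n, ‖c n‖ ≤ 1) :
    taylorCoeff (fun z => ∑' n, c n * z ^ n) = c := by
  have h := hasFPowerSeriesOnBall_of_norm_le_one hc
  have := h.analyticAt.hasFPowerSeriesAt.eq_formalMultilinearSeries h.hasFPowerSeriesAt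
  exact FormalMultilinearSeries.ofScalars_series_injective ℂ ℂ this

theorem norm_tsum_ge {c : ℕ → ℂ} (hc : ∀ n, ‖c n‖ ≤ 1) {z : ℂ} (hz : ‖z‖ < 1) (N : ℕ) :
    ‖∑ n ∈ Finset.range N, c n * z ^ n‖ - ‖z‖ ^ N / (1 - ‖z‖) ≤ ‖∑' n, c n * z ^ n‖ := by
  have hb : ∀ n, ‖c n * z ^ n‖ ≤ ‖z‖ ^ n := fun n => by
    rw [norm_mul, norm_pow]
    exact mul_le_of_le_one_left (by positivity) (hc n)
  have hg := hasSum_geometric_of_lt_one (norm_nonneg z) hz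
  have hs : Summable fun n => c n * z ^ n := Summable.of_norm_bounded hg.summable hb
  have ht : ‖∑' n, c (n + N) * z ^ (n + N)‖ ≤ ‖z‖ ^ N / (1 - ‖z‖) := by
    refine tsum_of_norm_bounded (f := fun n => c (n + N) * z ^ (n + N))
      (g := fun n => ‖z‖ ^ N * ‖z‖ ^ n) ?_ fun n => ?_
    · rw [div_eq_mul_inv]
      exact hg.mul_left _
    · rw [← pow_add, add_comm N n]
      exact hb (n + N)
  rw [← hs.sum_add_tsum_nat_add N]
  have := norm_sub_norm_le (∑ n ∈ Finset.range N, c n * z ^ n)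
    (-∑' n, c (n + N) * z ^ (n + N))
  rw [norm_neg, sub_neg_eq_add] at this
  linarith

theorem limsup_iInf_sphere_eq_top {f : ℂ → ℂ}
    (h : ∀ k : ℕ, ∃ r : ℝ, 1 - 1 / ((k : ℝ) + 1) < r ∧ r < 1 ∧
      ∀ z : ℂ, ‖z‖ = r → (k : ℝ) ≤ ‖f z‖) :
    limsup (fun r : ℝ => ⨅ z ∈ Metric.sphere (0 : ℂ) r, ‖f z‖ₑ) (𝓝[<] (1 : ℝ)) = ⊤ := by
  refine ENNReal.eq_top_of_forall_nnreal_le fun K => le_limsup_of_frequently_le ?_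
  rw [frequently_iff]
  intro U hU
  obtain ⟨l, hl, hlU⟩ := (mem_nhdsLT_iff_exists_Ioo_subset' (zero_lt_one' ℝ)).1 hU
  obtain ⟨k₁, hk₁⟩ := exists_nat_one_div_lt (show (0 : ℝ) < 1 - l from sub_pos.2 hl)
  obtain ⟨k₂, hk₂⟩ := exists_nat_ge (K : ℝ)
  obtain ⟨r, hr, hr1, hz⟩ := h (max k₁ k₂)
  refine ⟨r, hlU ⟨?_, hr1⟩, le_iInf₂ fun z hzr => ?_⟩
  · have : 1 / (((max k₁ k₂ : ℕ) : ℝ) + 1) ≤ 1 / ((k₁ : ℝ) + 1) := by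
      gcongr
      exact le_max_left _ _
    linarith
  · have h1 : (K : ℝ) ≤ ‖f z‖ := (hk₂.trans (by exact_mod_cast le_max_right _ _)).trans
      (hz z (by simpa using hzr))
    rw [enorm_eq_nnnorm]
    exact_mod_cast h1

theorem theorem4 (φ : ℝ → ℝ)
    (hmono : MonotoneOn φ (Set.Ioi 0))
    (hpos : ∀ x : ℝ, 0 < x → 0 < φ x)
    (hlim : Tendsto φ atTop atTop) :
    ∃ f : ℂ → ℂ, StronglyAnnular f ∧ taylorCoeff f ∈ ellTwoPhi φ \ ellTwoTilde := by
  obtain ⟨c, M, hM0, h⟩ := exists_seq_isExtension hlim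
  have hid : ∀ k, k ≤ M k := (strictMono_nat_of_lt_succ fun k => (h k).lt).id_le
  have hle : ∀ k, M k ≤ M (k + 1) := fun k => (h k).lt.le
  have hc : ∀ n, ‖c n‖ ≤ 1 := by
    have : ∀ k, ∀ n < 2 * M k, ‖c n‖ ≤ 1 := by
      intro k
      induction k with
      | zero => intro n hn; omega
      | succ k ih =>
        intro n hn
        by_cases hk : n < 2 * M k
        · exact ih n hk
        · exact (h k).norm_le n (not_lt.1 hk) hn
    exact fun n => this (n + 1) n (by have := hid (n + 1); omega)
  refine ⟨fun z => ∑' n, c n * z ^ n, ⟨?_, limsup_iInf_sphere_eq_top fun k => ?_⟩, ?_⟩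
  · have := (hasFPowerSeriesOnBall_of_norm_le_one hc).analyticOnNhd
    rwa [← ENNReal.ofReal_one, Metric.eball_ofReal] at this
  · obtain ⟨r, hrk, -, hr1, hr, hz⟩ := (h k).large
    refine ⟨r, hrk, hr1, fun z hzr => ?_⟩
    -- The tail costs at most 1, turning the bound `k + 1` for the partial sum into `k`.
    have := norm_tsum_ge hc (hzr ▸ hr1) (2 * M (k + 1))
    rw [hzr] at this
    linarith [hz z hzr]
  · rw [taylorCoeff_tsum hc]
    constructor
    · have h0 : ∀ n, 0 ≤ ‖c n‖ ^ 2 / φ (1 / ‖c n‖) := fun n => by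
        rcases eq_or_ne (c n) 0 with h | h
        · simp [h]
        · exact div_nonneg (by positivity) (hpos _ (one_div_pos.2 (norm_pos_iff.2 h))).le
      have hsum : ∀ k, ∑ n ∈ Finset.range (2 * M k), ‖c n‖ ^ 2 / φ (1 / ‖c n‖) ≤
          ∑ i ∈ Finset.range k, (1 / 2 : ℝ) ^ i := by
        intro k
        induction k with
        | zero => simp [hM0]
        | succ k ih =>
          rw [← Finset.sum_range_add_sum_Ico _ (Nat.mul_le_mul_left 2 (hle k)),
            Finset.sum_range_succ]
          exact add_le_add ih (h k).phi_le
      refine summable_of_sum_range_le (c := 2) h0 fun n => ?_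
      refine le_trans (Finset.sum_le_sum_of_subset_of_nonneg (Finset.range_mono ?_)
        fun i _ _ => h0 i) ((hsum n).trans (sum_geometric_two_le n))
      have := hid n
      omega
    · intro hs
      have hsum : ∀ k : ℕ, (k : ℝ) ≤
          ∑ i ∈ Finset.range (M k), min (‖c (2 * i)‖ ^ 2) (‖c (2 * i + 1)‖ ^ 2) := by
        intro k
        induction k with
        | zero => simp [hM0]
        | succ k ih =>
          rw [← Finset.sum_range_add_sum_Ico _ (hle k), Nat.cast_succ]
          exact add_le_add ih (h k).le_tilde
      obtain ⟨k, hk⟩ := exists_nat_gt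
        (∑' i, min (‖c (2 * i)‖ ^ 2) (‖c (2 * i + 1)‖ ^ 2))
      have := Summable.sum_le_tsum (Finset.range (M k)) (fun i _ => by positivity) hs
      linarith [hsum k]
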